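/- Consider a linear switched system with modes $\Omega=\{1,\dots,M\}$, $M\ge 1$, $$\dot x(t)=A_{q(t)}x(t)+B_{q(t)}u(t),\quad x(0)=0,\qquad y(t)=C_{q(t)}x(t),\qquad t\ge 0,$$ where $A_j\in\mathbb R^{n\times n}$, $B_j\in\mathbb R^{n\times m}$, $C_j\in\mathbb R^{p\times n}$ and the switching signal $q:[0,\infty)\to\Omega$ is piecewise constant. Put $D_j=A_j-A_1$ for $j\in\Omega$. Let $\mathcal P,\mathcal Q\in\mathbb R^{n\times n}$ be symmetric positive definite solutions of the generalized Lyapunov equations $$A_1\mathcal P+\mathcal PA_1^T+\sum_{j=1}^M\bigl(D_j\mathcal PD_j^T+B_jB_j^T\bigr)=0,\qquad A_1^T\mathcal Q+\mathcal QA_1+\sum_{j=1}^M\bigl(D_j^T\mathcal QD_j+C_j^TC_j\bigr)=0,$$ and suppose that, for every $k=2,\dots,M$, $$D_k\mathcal P+\mathcal PD_k^T\le\sum_{j=1}^MD_j\mathcal PD_j^T+\sum_{j\ne k}B_jB_j^T,\qquad D_k^T\mathcal Q+\mathcal QD_k\le\sum_{j=1}^MD_j^T\mathcal QD_j+\sum_{j\ne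 k}C_j^TC_j,$$ where $X\le Y$ means that $Y-X$ is positive semidefinite. Then, for every $k\in\Omega$, $$A_k\mathcal P+\mathcal PA_k^T+B_kB_k^T\le 0,\qquad A_k^T\mathcal Q+\mathcal QA_k+C_k^TC_k\le 0.$$ Moreover, let $0\le r\le n$ and let the reduced model of order $r$ be obtained by square-root balanced truncation: take square matrices $S,R$ with $\mathcal P=SS^T$, $\mathcal Q=RR^T$, and a singular value decomposition $S^TR=U\,\mathrm{diag}(\sigma_1,\dots,\sigma_n)\,Z^T$ with $U,Z$ orthogonal and $\sigma_i\ge 0$ (listed in any order, in particular in nonincreasing order); let $U_1,Z_1$ consist of the first $r$ columns of $U,Z$ and $\Sigma_1=\mathrm{diag}(\sigma_1,\dots,\sigma_r)$; put $V=SU_1\Sigma_1^{-1/2}$, $W=RZ_1\Sigma_1^{-1/2}$ and $\hat A_j=W^TA_jV$, $\hat B_j=W^TB_j$, $\hat C_j=C_jV$ for $j\in\Omega$. Let $y$ and $\hat y$ be the outputs, from zero initial states, of the original system and of the reduced system $$\dot{\hat x}(t)=\hat A_{q(t)}\hat x(t)+\hat B_{q(t)}u(t),\quad \hat x(0)=0,\qquad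 \hat y(t)=\hat C_{q(t)}\hat x(t).$$ Then, for every switching signal $q$ and every input $u\in L_2([0,\infty);\mathbb R^m)$, the error $y-\hat y$ belongs to $L_2([0,\infty);\mathbb R^p)$ and $$\|y-\hat y\|_{L_2}\le 2\Bigl(\sum_{k=r+1}^n\sigma_k\Bigr)\|u\|_{L_2}.$$ -/

import Mathlib

open Matrix MeasureTheory Set
open scoped ENNReal

/-- A linear switched system with modes `Fin M` (mode `1` of the text is `0 : Fin M`), state
dimension `n`, input dimension `m` and output dimension `p`:
`x' = A_{q(t)} x + B_{q(t)} u`, `y = C_{q(t)} x`. -/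
structure LSS (M n m p : ℕ) where
  A : Fin M → Matrix (Fin n) (Fin n) ℝ
  B : Fin M → Matrix (Fin n) (Fin m) ℝ
  C : Fin M → Matrix (Fin p) (Fin n) ℝ

/-- Switching signals on `[0, ∞)`: piecewise constant functions, i.e. there is a set of switching
times, finite in every bounded interval, between which the signal is constant. -/
def IsSwitchingSignal {M : ℕ} (q : ℝ → Fin M) : Prop :=
  ∃ S : Set ℝ, (∀ T : ℝ, (S ∩ Icc 0 T).Finite) ∧
    ∀ s t : ℝ, 0 ≤ s → s ≤ t → (∀ τ ∈ Icc s t, τ ∉ S) → q s = q t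

/-- The function `f : [0, ∞) → ℝᵏ` is square integrable, for the Euclidean norm on `ℝᵏ`. -/
def IsL2 {k : ℕ} (f : ℝ → Fin k → ℝ) : Prop :=
  MemLp (fun t => WithLp.toLp 2 (f t)) 2 (volume.restrict (Ici (0 : ℝ)))

/-- The `L²` norm on `[0, ∞)` of `f : [0, ∞) → ℝᵏ`, for the Euclidean norm on `ℝᵏ`. -/
noncomputable def normL2 {k : ℕ} (f : ℝ → Fin k → ℝ) : ℝ≥0∞ :=
  eLpNorm (fun t => WithLp.toLp 2 (f t)) 2 (volume.restrict (Ici (0 : ℝ)))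

namespace LSS

variable {M n m p : ℕ}

/-- `x` is the state trajectory on `[0, ∞)` with initial state `x₀`, input `u` and switching
signal `q`: the (Carathéodory) solution of the differential equation, in integral form. -/
structure IsTrajectory (sys : LSS M n m p) (x₀ : Fin n → ℝ) (q : ℝ → Fin M)
    (u : ℝ → Fin m → ℝ) (x : ℝ → Fin n → ℝ) : Prop where
  continuousOn : ContinuousOn x (Ici 0)
  eq_integral : ∀ t : ℝ, 0 ≤ t →
    x t = x₀ + ∫ s in (0 : ℝ)..t, (sys.A (q s) *ᵥ x s + sys.B (q s) *ᵥ u s)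

/-- The output `y(t) = C_{q(t)} x(t)`. -/
def output (sys : LSS M n m p) (q : ℝ → Fin M) (x : ℝ → Fin n → ℝ) : ℝ → Fin p → ℝ :=
  fun t => sys.C (q t) *ᵥ x t

/-- `D_j = A_j - A`, where `A` is the state matrix of the first mode. -/
def D [NeZero M] (sys : LSS M n m p) (j : Fin M) : Matrix (Fin n) (Fin n) ℝ :=
  sys.A j - sys.A 0

/-- The generalized Lyapunov equation for reachability. -/
def ReachLyapunov [NeZero M] (sys : LSS M n m p) (P : Matrix (Fin n) (Fin n) ℝ) : Prop :=
  sys.A 0 * P + P * (sys.A 0)ᵀ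
    + ∑ j, (sys.D j * P * (sys.D j)ᵀ + sys.B j * (sys.B j)ᵀ) = 0

/-- The generalized Lyapunov equation for observability. -/
def ObsLyapunov [NeZero M] (sys : LSS M n m p) (Q : Matrix (Fin n) (Fin n) ℝ) : Prop :=
  (sys.A 0)ᵀ * Q + Q * sys.A 0
    + ∑ j, ((sys.D j)ᵀ * Q * sys.D j + (sys.C j)ᵀ * sys.C j) = 0

/-- `P` and `Q` are symmetric positive definite solutions of the generalized Lyapunov equations
and satisfy the linear matrix inequalities below for every mode other than the first one.
An inequality `X ≤ Y` of symmetric matrices means that `Y - X` is positive semidefinite. -/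
structure GramianAssumption [NeZero M] (sys : LSS M n m p)
    (P Q : Matrix (Fin n) (Fin n) ℝ) : Prop where
  posDef_P : P.PosDef
  posDef_Q : Q.PosDef
  reach : sys.ReachLyapunov P
  obs : sys.ObsLyapunov Q
  lmi_P : ∀ k : Fin M, k ≠ 0 →
    ((∑ j, sys.D j * P * (sys.D j)ᵀ + ∑ j ∈ Finset.univ.erase k, sys.B j * (sys.B j)ᵀ)
      - (sys.D k * P + P * (sys.D k)ᵀ)).PosSemidef
  lmi_Q : ∀ k : Fin M, k ≠ 0 →
    ((∑ j, (sys.D j)ᵀ * Q * sys.D j + ∑ j ∈ Finset.univ.erase k, (sys.C j)ᵀ * sys.C j)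
      - ((sys.D k)ᵀ * Q + Q * sys.D k)).PosSemidef

/-- The reduced model `(Wᵀ A_j V, Wᵀ B_j, C_j V)` given by projection matrices `V`, `W`. -/
def project (sys : LSS M n m p) {r : ℕ} (V W : Matrix (Fin n) (Fin r) ℝ) : LSS M r m p where
  A j := Wᵀ * sys.A j * V
  B j := Wᵀ * sys.B j
  C j := sys.C j * V

end LSS

/-- The factorizations computed by square-root balanced truncation: `P = S Sᵀ`, `Q = R Rᵀ` and a
singular value decomposition `Sᵀ R = U diag(σ) Zᵀ`. Triangular shape of `S`, `R` is not required,
and the singular values may be listed in any order (in particular in the nonincreasing one). -/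
structure BalancingFactors {n : ℕ} (P Q : Matrix (Fin n) (Fin n) ℝ) where
  S : Matrix (Fin n) (Fin n) ℝ
  R : Matrix (Fin n) (Fin n) ℝ
  U : Matrix (Fin n) (Fin n) ℝ
  Z : Matrix (Fin n) (Fin n) ℝ
  σ : Fin n → ℝ
  P_eq : P = S * Sᵀ
  Q_eq : Q = R * Rᵀ
  U_mem : U ∈ Matrix.orthogonalGroup (Fin n) ℝ
  Z_mem : Z ∈ Matrix.orthogonalGroup (Fin n) ℝ
  σ_nonneg : ∀ i, 0 ≤ σ i
  svd : Sᵀ * R = U * Matrix.diagonal σ * Zᵀ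

namespace BalancingFactors

variable {n : ℕ} {P Q : Matrix (Fin n) (Fin n) ℝ}

/-- `Σ₁^{-1/2}`, where `Σ₁ = diag(σ₁, …, σ_r)`. -/
noncomputable def invSqrt (F : BalancingFactors P Q) {r : ℕ} (hr : r ≤ n) :
    Matrix (Fin r) (Fin r) ℝ :=
  Matrix.diagonal fun i => (Real.sqrt (F.σ (Fin.castLE hr i)))⁻¹

/-- The projection matrix `V = S U₁ Σ₁^{-1/2}`, where `U₁` is made of the first `r` columns
of `U`. -/
noncomputable def projV (F : BalancingFactors P Q) {r : ℕ} (hr : r ≤ n) :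
    Matrix (Fin n) (Fin r) ℝ :=
  F.S * F.U.submatrix id (Fin.castLE hr) * F.invSqrt hr

/-- The projection matrix `W = R Z₁ Σ₁^{-1/2}`, where `Z₁` is made of the first `r` columns
of `Z`. -/
noncomputable def projW (F : BalancingFactors P Q) {r : ℕ} (hr : r ≤ n) :
    Matrix (Fin n) (Fin r) ℝ :=
  F.R * F.Z.submatrix id (Fin.castLE hr) * F.invSqrt hr

/-- The reduced model of order `r` produced by square-root balanced truncation. -/
noncomputable def reduced (F : BalancingFactors P Q) {M m p : ℕ} (sys : LSS M n m p)
    {r : ℕ} (hr : r ≤ n) : LSS M r m p :=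
  sys.project (F.projV hr) (F.projW hr)

end BalancingFactors

/-! Subtracting the mode inequality from the generalized Lyapunov equation leaves exactly the
Lyapunov inequality of that mode, so `P` and `Q` serve all modes at once. In the coordinates given
by `fullV` and `fullW` both become the same matrix Σ = diag σ, and the reduced model is obtained by
deleting rows and columns.

State coordinates are removed one at a time. The intermediate systems keep the state space ℝⁿ and
hold the deleted coordinates at zero (`mask`), so the inequalities of the full balanced system apply
to all of them and none has to be derived for truncations. Let x and z be the states before and
after the removal of coordinate k. The storage function (x-z)ᵀΣ(x-z) + σ_k²(x+z)ᵀΣ⁻¹(x+z) has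
derivative at most 4σ_k²|u|² - |C(x-z)|² in every mode (`IsBalanced.dissipation`): the observability
inequality treats the first term, the reachability inequality the second, and the two defects caused
by the deleted equation cancel. As the function does not depend on the mode, switching is harmless.

Integration over [0,T] from the zero state costs 2σ_k per removed coordinate
(`IsBalanced.eLpNorm_output_sub_le`), and the triangle inequality adds these costs
(`IsBalanced.eLpNorm_output_sub_mask_le`). The bound is uniform in T, so monotone convergence gives
the half-line. -/

/-! ### Lyapunov inequalities of the individual modes. -/

/-- A generalized Lyapunov equation together with the mode inequality gives the Lyapunov
inequality of that mode. -/
theorem posSemidef_neg_lyapunov_of_generalized {M n m : ℕ}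
    (A D : Matrix (Fin n) (Fin n) ℝ) (P E : Matrix (Fin n) (Fin n) ℝ)
    (B : Fin M → Matrix (Fin n) (Fin m) ℝ) (k : Fin M)
    (h : A * P + P * Aᵀ + (E + ∑ j, B j * (B j)ᵀ) = 0)
    (hk : ((E + ∑ j ∈ Finset.univ.erase k, B j * (B j)ᵀ) - (D * P + P * Dᵀ)).PosSemidef) :
    (-((A + D) * P + P * (A + D)ᵀ + B k * (B k)ᵀ)).PosSemidef := by
  convert hk using 1
  have h1 := Finset.add_sum_erase Finset.univ (fun j => B j * (B j)ᵀ) (Finset.mem_univ k)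
  rw [← h1] at h
  rw [transpose_add, add_mul, mul_add, ← sub_eq_zero, ← neg_eq_zero, ← h]
  abel

theorem posSemidef_sum_mul_mul_transpose {M n : ℕ} {P : Matrix (Fin n) (Fin n) ℝ}
    (hP : P.PosSemidef) (D : Fin M → Matrix (Fin n) (Fin n) ℝ) :
    (∑ j, D j * P * (D j)ᵀ).PosSemidef :=
  posSemidef_sum _ fun j _ => by simpa using hP.mul_mul_conjTranspose_same (D j)

theorem posSemidef_sum_mul_transpose {M n m : ℕ} (s : Finset (Fin M))
    (B : Fin M → Matrix (Fin n) (Fin m) ℝ) :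
    (∑ j ∈ s, B j * (B j)ᵀ).PosSemidef :=
  posSemidef_sum _ fun j _ => by simpa using posSemidef_self_mul_conjTranspose (B j)

namespace LSS

variable {M n m p : ℕ}

theorem GramianAssumption.reach_lyapunov [NeZero M] {sys : LSS M n m p}
    {P Q : Matrix (Fin n) (Fin n) ℝ} (h : sys.GramianAssumption P Q) (k : Fin M) :
    (-(sys.A k * P + P * (sys.A k)ᵀ + sys.B k * (sys.B k)ᵀ)).PosSemidef := by
  have h0 : sys.A k = sys.A 0 + sys.D k := by simp [D]
  rw [h0]
  refine posSemidef_neg_lyapunov_of_generalized _ _ P (∑ j, sys.D j * P * (sys.D j)ᵀ) _ k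
    (by rw [← Finset.sum_add_distrib]; exact h.reach) ?_
  -- For the first mode `D 0 = 0`, so the mode inequality reduces to the positivity of sums of
  -- congruences and need not be assumed.
  rcases eq_or_ne k 0 with rfl | hk
  · simpa [D] using (posSemidef_sum_mul_mul_transpose h.posDef_P.posSemidef sys.D).add
      (posSemidef_sum_mul_transpose (Finset.univ.erase 0) sys.B)
  · exact h.lmi_P k hk

theorem GramianAssumption.obs_lyapunov [NeZero M] {sys : LSS M n m p}
    {P Q : Matrix (Fin n) (Fin n) ℝ} (h : sys.GramianAssumption P Q) (k : Fin M) :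
    (-((sys.A k)ᵀ * Q + Q * sys.A k + (sys.C k)ᵀ * sys.C k)).PosSemidef := by
  have h0 : sys.A k = sys.A 0 + sys.D k := by simp [D]
  have := posSemidef_neg_lyapunov_of_generalized (sys.A 0)ᵀ (sys.D k)ᵀ Q
    (∑ j, (sys.D j)ᵀ * Q * sys.D j) (fun j => (sys.C j)ᵀ) k
    (by simp only [transpose_transpose]; rw [← Finset.sum_add_distrib]; exact h.obs) ?_
  · rw [h0]; simpa using this
  simp only [transpose_transpose]
  rcases eq_or_ne k 0 with rfl | hk
  · simpa [D] using (posSemidef_sum_mul_mul_transpose h.posDef_Q.posSemidef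
      (fun j => (sys.D j)ᵀ)).add
      (posSemidef_sum_mul_transpose (Finset.univ.erase 0) (fun j => (sys.C j)ᵀ))
  · exact h.lmi_Q k hk

end LSS

/-! ### Balanced coordinates. -/

theorem dotProduct_transpose_mulVec {n m : ℕ} (A : Matrix (Fin n) (Fin m) ℝ)
    (x : Fin m → ℝ) (y : Fin n → ℝ) : x ⬝ᵥ (Aᵀ *ᵥ y) = (A *ᵥ x) ⬝ᵥ y := by
  rw [mulVec_transpose, dotProduct_comm, ← dotProduct_mulVec, dotProduct_comm]

/-- Symmetry of `P` makes the two Lyapunov terms equal as quadratic forms. Changing coordinates then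
only means choosing `v` in the range of `fullV` or `fullW`. -/
theorem two_mul_dotProduct_add_le_zero {n m : ℕ} {A P : Matrix (Fin n) (Fin n) ℝ}
    {B : Matrix (Fin n) (Fin m) ℝ} (hP : Pᵀ = P)
    (h : (-(A * P + P * Aᵀ + B * Bᵀ)).PosSemidef) (v : Fin n → ℝ) :
    2 * (v ⬝ᵥ A *ᵥ (P *ᵥ v)) + (Bᵀ *ᵥ v) ⬝ᵥ (Bᵀ *ᵥ v) ≤ 0 := by
  have h1 := h.dotProduct_mulVec_nonneg v
  have h2 : v ⬝ᵥ ((P * Aᵀ) *ᵥ v) = v ⬝ᵥ A *ᵥ (P *ᵥ v) := by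
    rw [dotProduct_mulVec, ← mulVec_transpose, dotProduct_comm]
    simp [hP]
  have h3 : v ⬝ᵥ ((B * Bᵀ) *ᵥ v) = (Bᵀ *ᵥ v) ⬝ᵥ (Bᵀ *ᵥ v) := by
    rw [← mulVec_mulVec, dotProduct_mulVec, ← mulVec_transpose]
  simp only [star_trivial, neg_mulVec, add_mulVec, dotProduct_neg, dotProduct_add, h2, h3] at h1
  rw [← mulVec_mulVec] at h1
  linarith

namespace BalancingFactors

variable {n : ℕ} {P Q : Matrix (Fin n) (Fin n) ℝ} (F : BalancingFactors P Q)

/-- `S` and `R` are invertible because `P` and `Q` are, so no factor of the determinant of the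
singular value decomposition vanishes. Hence `invSqrt` never inverts zero. -/
theorem sigma_pos (hP : P.PosDef) (hQ : Q.PosDef) (i : Fin n) : 0 < F.σ i := by
  have hS : F.S.det ≠ 0 := fun h => hP.det_pos.ne' (by rw [F.P_eq, det_mul, h, zero_mul])
  have hR : F.R.det ≠ 0 := fun h => hQ.det_pos.ne' (by rw [F.Q_eq, det_mul, h, zero_mul])
  refine (F.σ_nonneg i).lt_of_ne' fun h => ?_
  have h1 := congrArg det F.svd
  rw [det_mul, det_mul, det_mul, det_diagonal, Finset.prod_eq_zero (Finset.mem_univ i) h,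
    mul_zero, zero_mul, det_transpose] at h1
  exact mul_ne_zero hS hR h1

/-- The balancing transformation `V = S U Σ^{-1/2}` of full order. -/
noncomputable abbrev fullV : Matrix (Fin n) (Fin n) ℝ := F.projV le_rfl

/-- The balancing transformation `W = R Z Σ^{-1/2}` of full order. -/
noncomputable abbrev fullW : Matrix (Fin n) (Fin n) ℝ := F.projW le_rfl

theorem fullV_eq : F.fullV = F.S * F.U * diagonal (fun i => (Real.sqrt (F.σ i))⁻¹) := rfl

theorem fullW_eq : F.fullW = F.R * F.Z * diagonal (fun i => (Real.sqrt (F.σ i))⁻¹) := rfl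

/-- Reduction of order r is thus truncation of the full balanced realization. -/
theorem projV_eq_submatrix {r : ℕ} (hr : r ≤ n) :
    F.projV hr = F.fullV.submatrix id (Fin.castLE hr) := by
  ext i j
  simp only [projV, fullV, invSqrt, mul_diagonal, submatrix_apply]
  simp [mul_apply]

theorem projW_eq_submatrix {r : ℕ} (hr : r ≤ n) :
    F.projW hr = F.fullW.submatrix id (Fin.castLE hr) := by
  ext i j
  simp only [projW, fullW, invSqrt, mul_diagonal, submatrix_apply]
  simp [mul_apply]

theorem U_transpose_mul : F.Uᵀ * F.U = 1 := by
  simpa [star_eq_conjTranspose] using (mem_orthogonalGroup_iff' (Fin n) ℝ).1 F.U_mem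

theorem Z_transpose_mul : F.Zᵀ * F.Z = 1 := by
  simpa [star_eq_conjTranspose] using (mem_orthogonalGroup_iff' (Fin n) ℝ).1 F.Z_mem

/-- Substituting the singular value decomposition into S(SᵀR)Z gives SUΣ. Together with WᵀV = 1 this
says WᵀPW = Σ, in a form that needs no inverse. -/
theorem mul_fullW : P * F.fullW = F.fullV * diagonal F.σ := by
  rw [fullW_eq, fullV_eq]
  nth_rw 1 [F.P_eq]
  calc F.S * F.Sᵀ * (F.R * F.Z * diagonal fun i => (√(F.σ i))⁻¹)
      = F.S * (F.Sᵀ * F.R) * F.Z * diagonal fun i => (√(F.σ i))⁻¹ := by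
        simp only [Matrix.mul_assoc]
    _ = F.S * F.U * diagonal F.σ * (F.Zᵀ * F.Z) * diagonal fun i => (√(F.σ i))⁻¹ := by
        rw [F.svd]; simp only [Matrix.mul_assoc]
    _ = _ := by
        rw [F.Z_transpose_mul, Matrix.mul_one, Matrix.mul_assoc, Matrix.mul_assoc _ (diagonal _),
          diagonal_mul_diagonal, diagonal_mul_diagonal]
        simp only [mul_comm]

theorem svd_transpose : F.Rᵀ * F.S = F.Z * diagonal F.σ * F.Uᵀ := by
  have := congrArg transpose F.svd
  simpa [transpose_mul, Matrix.mul_assoc] using this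

theorem mul_fullV : Q * F.fullV = F.fullW * diagonal F.σ := by
  rw [fullW_eq, fullV_eq]
  nth_rw 1 [F.Q_eq]
  calc F.R * F.Rᵀ * (F.S * F.U * diagonal fun i => (√(F.σ i))⁻¹)
      = F.R * (F.Rᵀ * F.S) * F.U * diagonal fun i => (√(F.σ i))⁻¹ := by
        simp only [Matrix.mul_assoc]
    _ = F.R * F.Z * diagonal F.σ * (F.Uᵀ * F.U) * diagonal fun i => (√(F.σ i))⁻¹ := by
        rw [F.svd_transpose]; simp only [Matrix.mul_assoc]
    _ = _ := by
        rw [F.U_transpose_mul, Matrix.mul_one, Matrix.mul_assoc, Matrix.mul_assoc _ (diagonal _),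
          diagonal_mul_diagonal, diagonal_mul_diagonal]
        simp only [mul_comm]

theorem fullW_transpose_mul_fullV (hσ : ∀ i, 0 < F.σ i) : F.fullWᵀ * F.fullV = 1 := by
  rw [fullW_eq, fullV_eq]
  calc (F.R * F.Z * diagonal fun i => (√(F.σ i))⁻¹)ᵀ *
        (F.S * F.U * diagonal fun i => (√(F.σ i))⁻¹)
      = diagonal (fun i => (√(F.σ i))⁻¹) * F.Zᵀ * (F.Rᵀ * F.S) * F.U *
          diagonal fun i => (√(F.σ i))⁻¹ := by
        simp only [transpose_mul, diagonal_transpose, Matrix.mul_assoc]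
    _ = diagonal (fun i => (√(F.σ i))⁻¹) * (F.Zᵀ * F.Z) * diagonal F.σ * (F.Uᵀ * F.U) *
          diagonal fun i => (√(F.σ i))⁻¹ := by
        rw [F.svd_transpose]; simp only [Matrix.mul_assoc]
    _ = 1 := by
        rw [F.Z_transpose_mul, F.U_transpose_mul, Matrix.mul_one, Matrix.mul_one,
          diagonal_mul_diagonal, diagonal_mul_diagonal, ← diagonal_one]
        congr 1
        ext i
        have := Real.sq_sqrt (hσ i).le
        have h0 := (Real.sqrt_pos.2 (hσ i)).ne'
        field_simp
        exact this.symm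

/-- The balanced realization satisfies the observability inequality with `Σ`. -/
theorem reduced_obs {M m p : ℕ} (sys : LSS M n m p) (hQ : Qᵀ = Q) (k : Fin M)
    (h : (-((sys.A k)ᵀ * Q + Q * sys.A k + (sys.C k)ᵀ * sys.C k)).PosSemidef)
    (e : Fin n → ℝ) :
    2 * ((diagonal F.σ *ᵥ e) ⬝ᵥ ((F.reduced sys le_rfl).A k *ᵥ e)) +
      ((F.reduced sys le_rfl).C k *ᵥ e) ⬝ᵥ ((F.reduced sys le_rfl).C k *ᵥ e) ≤ 0 := by
  have h1 := two_mul_dotProduct_add_le_zero (A := (sys.A k)ᵀ) (B := (sys.C k)ᵀ) hQ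
    (by simpa using h) (F.fullV *ᵥ e)
  convert h1 using 3
  · have h2 : Q *ᵥ (F.fullV *ᵥ e) = F.fullW *ᵥ (diagonal F.σ *ᵥ e) := by
      rw [mulVec_mulVec, F.mul_fullV, mulVec_mulVec]
    rw [h2, dotProduct_transpose_mulVec, dotProduct_comm (sys.A k *ᵥ _)]
    simp only [reduced, LSS.project]
    rw [← mulVec_mulVec, ← mulVec_mulVec, dotProduct_transpose_mulVec]
  · simp [reduced, LSS.project, mulVec_mulVec]
  · simp [reduced, LSS.project, mulVec_mulVec]

/-- The balanced realization satisfies the reachability inequality with `Σ`. -/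
theorem reduced_reach {M m p : ℕ} (sys : LSS M n m p) (hP : Pᵀ = P) (k : Fin M)
    (h : (-(sys.A k * P + P * (sys.A k)ᵀ + sys.B k * (sys.B k)ᵀ)).PosSemidef)
    (v : Fin n → ℝ) :
    2 * (v ⬝ᵥ ((F.reduced sys le_rfl).A k *ᵥ (diagonal F.σ *ᵥ v))) +
      (((F.reduced sys le_rfl).B k)ᵀ *ᵥ v) ⬝ᵥ (((F.reduced sys le_rfl).B k)ᵀ *ᵥ v) ≤ 0 := by
  have h1 := two_mul_dotProduct_add_le_zero hP h (F.fullW *ᵥ v)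
  convert h1 using 3
  · have h2 : P *ᵥ (F.fullW *ᵥ v) = F.fullV *ᵥ (diagonal F.σ *ᵥ v) := by
      rw [mulVec_mulVec, F.mul_fullW, mulVec_mulVec]
    rw [h2]
    simp only [reduced, LSS.project]
    rw [← mulVec_mulVec, ← mulVec_mulVec, dotProduct_transpose_mulVec]
  · simp [reduced, LSS.project, mulVec_mulVec]
  · simp [reduced, LSS.project, mulVec_mulVec]

end BalancingFactors

/-! ### Measurability, the energy identity, solvability of the state equation and L² norms. -/

/-- A switching signal is measurable up to the null set of switching times. -/
theorem IsSwitchingSignal.aemeasurable {M : ℕ} {q : ℝ → Fin M} (hq : IsSwitchingSignal q) :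
    AEMeasurable q (volume.restrict (Ici (0 : ℝ))) := by
  obtain ⟨S, hS, hc⟩ := hq
  -- Local finiteness of the switching times makes their complement open. There the signal is
  -- locally constant, hence continuous. The endpoint 0 is dropped to have an open set.
  have hU : IsOpen (Ioi (0 : ℝ) \ S) := by
    rw [isOpen_iff_mem_nhds]
    rintro t ⟨ht, htS⟩
    have h1 : Ioo 0 (t + 1) \ (S ∩ Icc 0 (t + 1)) ∈ nhds t :=
      (isOpen_Ioo.sdiff (hS (t + 1)).isClosed).mem_nhds
        ⟨⟨ht, by linarith⟩, fun h => htS h.1⟩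
    filter_upwards [h1] with τ hτ
    exact ⟨hτ.1.1, fun h => hτ.2 ⟨h, hτ.1.1.le, hτ.1.2.le⟩⟩
  have hcont : ContinuousOn q (Ioi (0 : ℝ) \ S) := by
    intro t ht
    obtain ⟨ε, hε, hball⟩ := Metric.isOpen_iff.1 hU t ht
    have h1 : ∀ᶠ τ in nhds t, q τ = q t := by
      filter_upwards [Metric.ball_mem_nhds t hε] with τ hτ
      have hsub : uIcc τ t ⊆ Metric.ball t ε := by
        rw [← segment_eq_uIcc]
        exact (convex_ball t ε).segment_subset hτ (Metric.mem_ball_self hε)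
      rcases le_total τ t with h | h
      · rw [uIcc_of_le h] at hsub
        exact hc τ t (hball hτ).1.le h fun x hx => (hball (hsub hx)).2
      · rw [uIcc_of_ge h] at hsub
        exact (hc t τ (le_of_lt ht.1) h fun x hx => (hball (hsub hx)).2).symm
    exact ((continuousAt_const (y := q t)).congr
      (h1.mono fun _ h => h.symm)).continuousWithinAt
  have hcount : (S ∩ Ici 0).Countable := by
    refine (countable_iUnion fun N : ℕ => (hS N).countable).mono ?_
    rintro t ⟨ht, ht0⟩
    obtain ⟨N, hN⟩ := exists_nat_ge t
    exact mem_iUnion.2 ⟨N, ht, ht0, hN⟩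
  have hae : (Ioi (0 : ℝ) \ S : Set ℝ) =ᵐ[volume] Ici (0 : ℝ) := by
    have h0 : ∀ᵐ t : ℝ, t ∉ S ∩ Ici 0 := hcount.ae_notMem _
    have h1 : ∀ᵐ t : ℝ, t ∉ ({0} : Set ℝ) := (countable_singleton _).ae_notMem _
    filter_upwards [h0, h1] with t ht ht1
    apply propext
    constructor
    · exact fun h => le_of_lt h.1
    · exact fun h => ⟨lt_of_le_of_ne h (Ne.symm ht1), fun hS => ht ⟨hS, h⟩⟩
  rw [← Measure.restrict_congr_set hae]
  exact hcont.aemeasurable hU.measurableSet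

/-- The primitive is only absolutely continuous, since `φ` is merely integrable. Integration by
parts for such functions replaces differentiation of the energy. -/
theorem sq_intervalIntegral_eq {φ : ℝ → ℝ} {a T : ℝ} (hφ : IntervalIntegrable φ volume a T) :
    (∫ s in a..T, φ s) ^ 2 = ∫ t in a..T, 2 * ((∫ s in a..t, φ s) * φ t) := by
  have hac := hφ.absolutelyContinuousOnInterval_intervalIntegral (c := a) left_mem_uIcc
  have h := hac.integral_deriv_mul_eq_sub hac
  simp only [intervalIntegral.integral_same, mul_zero, sub_zero] at h
  rw [sq, ← h]
  refine intervalIntegral.integral_congr_ae ?_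
  filter_upwards [hφ.ae_hasDerivAt_integral] with t ht hmem
  rw [(ht (uIoc_subset_uIcc hmem) a left_mem_uIcc).deriv]
  ring

/-- Existence for linear integral equations with bounded measurable coefficients. -/
theorem exists_continuousOn_eq_integral {E : Type*} [NormedAddCommGroup E] [NormedSpace ℝ E]
    [CompleteSpace E] {T a : ℝ} (hT : 0 ≤ T) (Φ : ℝ → E →L[ℝ] E) (f : ℝ → E)
    (hf : IntegrableOn f (Icc 0 T)) (ha : ∀ s, ‖Φ s‖ ≤ a)
    (hΦ : ∀ x : ℝ → E, Continuous x →
      AEStronglyMeasurable (fun s => Φ s (x s)) (volume.restrict (Icc 0 T))) :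
    ∃ x : ℝ → E, Continuous x ∧ ∀ t ∈ Icc 0 T, x t = ∫ s in (0 : ℝ)..t, (Φ s (x s) + f s) := by
  have ha0 : 0 ≤ a := (norm_nonneg _).trans (ha 0)
  -- The rate is chosen so that the contraction constant a / L is at most 1/2. The added 1 keeps `L`
  -- positive when `a = 0`.
  set L : ℝ := 2 * a + 1 with hL
  have hLpos : 0 < L := by positivity
  have hint : ∀ x : ℝ → E, Continuous x → IntegrableOn (fun s => Φ s (x s)) (Icc 0 T) := by
    intro x hx
    obtain ⟨b, hb⟩ := (isCompact_Icc (a := (0 : ℝ)) (b := T)).exists_bound_of_continuousOn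
      hx.continuousOn
    refine IntegrableOn.of_bound measure_Icc_lt_top (hΦ x hx) (a * b) ?_
    filter_upwards [ae_restrict_mem measurableSet_Icc] with s hs
    exact (Φ s).le_of_opNorm_le_of_le (ha s) (hb s hs)
  -- The unknown is `z s = exp (-L s) x s`: the sup norm of `z` is an exponentially weighted norm of
  -- `x`, for which one contraction covers all of [0,T] however large T is.
  let lift : C(Icc 0 T, E) → ℝ → E := fun z s => Real.exp (L * s) • IccExtend hT z s
  have hlift : ∀ z, Continuous (lift z) := fun z =>
    (by fun_prop : Continuous fun s : ℝ => Real.exp (L * s)).smul (z.continuous.Icc_extend')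
  have hint' : ∀ z : C(Icc 0 T, E), ∀ t ∈ Icc 0 T,
      IntervalIntegrable (fun s => Φ s (lift z s)) volume 0 t := fun z t ht =>
    ((hint _ (hlift z)).mono_set (by rw [uIcc_of_le ht.1]; exact Icc_subset_Icc_right ht.2)
      ).intervalIntegrable
  have hf' : ∀ t ∈ Icc 0 T, IntervalIntegrable f volume 0 t := fun t ht =>
    (hf.mono_set (by rw [uIcc_of_le ht.1]; exact Icc_subset_Icc_right ht.2)).intervalIntegrable
  let G : C(Icc 0 T, E) → C(Icc 0 T, E) := fun z =>
    ⟨fun t => Real.exp (-(L * t)) • ∫ s in (0 : ℝ)..t, (Φ s (lift z s) + f s), by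
      have h1 : ContinuousOn (fun t => ∫ s in (0 : ℝ)..t, (Φ s (lift z s) + f s)) (Icc 0 T) := by
        have := intervalIntegral.continuousOn_primitive_interval (μ := volume) (a := 0) (b := T)
          (f := fun s => Φ s (lift z s) + f s)
          (by rw [uIcc_of_le hT]; exact (hint _ (hlift z)).add hf)
        rwa [uIcc_of_le hT] at this
      have h2 := continuousOn_iff_continuous_domRestrict.1 h1
      exact (by fun_prop : Continuous fun t : Icc 0 T => Real.exp (-(L * t))).smul h2⟩
  have hGapp : ∀ z t, G z t = Real.exp (-(L * t)) • ∫ s in (0 : ℝ)..t, (Φ s (lift z s) + f s) :=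
    fun _ _ => rfl
  have hG : ContractingWith (1 / 2) G := by
    refine ⟨by norm_num, LipschitzWith.of_dist_le_mul fun z w => ?_⟩
    rw [ContinuousMap.dist_le (by positivity)]
    intro t
    obtain ⟨ht0, htT⟩ := t.2
    have hsub : G z t - G w t =
        Real.exp (-(L * t)) • ∫ s in (0 : ℝ)..t, (Φ s (lift z s) - Φ s (lift w s)) := by
      rw [hGapp, hGapp, ← smul_sub, ← intervalIntegral.integral_sub ((hint' z t t.2).add (hf' t t.2))
        ((hint' w t t.2).add (hf' t t.2))]
      simp
    have hbound : ‖∫ s in (0 : ℝ)..t, (Φ s (lift z s) - Φ s (lift w s))‖ ≤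
        ∫ s in (0 : ℝ)..t, a * dist z w * Real.exp (L * s) := by
      refine intervalIntegral.norm_integral_le_of_norm_le ht0 (ae_of_all _ fun s _ => ?_)
        (Continuous.intervalIntegrable (by fun_prop) _ _)
      rw [← map_sub]
      have h1 : ‖lift z s - lift w s‖ ≤ dist z w * Real.exp (L * s) := by
        change ‖Real.exp (L * s) • IccExtend hT z s - Real.exp (L * s) • IccExtend hT w s‖ ≤ _
        rw [← smul_sub, norm_smul, Real.norm_eq_abs, Real.abs_exp, mul_comm, ← dist_eq_norm]
        gcongr
        exact ContinuousMap.dist_apply_le_dist _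
      calc _ ≤ a * (dist z w * Real.exp (L * s)) := (Φ s).le_of_opNorm_le_of_le (ha s) h1
        _ = _ := by ring
    have hexp : ∫ s in (0 : ℝ)..t, a * dist z w * Real.exp (L * s) =
        a * dist z w * ((Real.exp (L * t) - 1) / L) := by
      rw [intervalIntegral.integral_const_mul, intervalIntegral.integral_comp_mul_left (fun s => Real.exp s) hLpos.ne',
        integral_exp, mul_zero, Real.exp_zero, smul_eq_mul, inv_mul_eq_div]
    rw [dist_eq_norm, hsub, norm_smul, Real.norm_eq_abs, Real.abs_exp]
    calc Real.exp (-(L * t)) * _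
        ≤ Real.exp (-(L * t)) * (a * dist z w * ((Real.exp (L * t) - 1) / L)) := by
          rw [← hexp]; gcongr
      _ = (a / L) * dist z w * (Real.exp (-(L * t)) * (Real.exp (L * t) - 1)) := by ring
      _ ≤ 1 / 2 * dist z w * 1 := by
          have h1 : Real.exp (-(L * t)) * (Real.exp (L * t) - 1) ≤ 1 := by
            rw [mul_sub, ← Real.exp_add, neg_add_cancel, Real.exp_zero]
            linarith [Real.exp_pos (-(L * t))]
          have h2 : a / L ≤ 1 / 2 := by rw [div_le_iff₀ hLpos]; linarith
          have h3 : 0 ≤ Real.exp (L * t) - 1 := by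
            rw [sub_nonneg, Real.one_le_exp_iff]; positivity
          exact mul_le_mul (mul_le_mul_of_nonneg_right h2 dist_nonneg) h1 (by positivity)
            (by positivity)
      _ = _ := by simp
  have hfix := hG.fixedPoint_isFixedPt
  set z := ContractingWith.fixedPoint G hG
  refine ⟨lift z, hlift z, fun t ht => ?_⟩
  have h1 : z ⟨t, ht⟩ = Real.exp (-(L * t)) • ∫ s in (0 : ℝ)..t, (Φ s (lift z s) + f s) :=
    (DFunLike.congr_fun hfix ⟨t, ht⟩).symm
  change Real.exp (L * t) • IccExtend hT z t = _
  rw [IccExtend_of_mem _ _ ht, h1, smul_smul, ← Real.exp_add, add_neg_cancel, Real.exp_zero,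
    one_smul]

/-- Multiplication by a coefficient matrix selected by a measurable mode preserves
square integrability. -/
theorem memLp_mode_mulVec {α : Type*} [MeasurableSpace α] {μ : Measure α} {M k l : ℕ}
    {q : α → Fin M} (hq : AEMeasurable q μ) (A : Fin M → Matrix (Fin k) (Fin l) ℝ)
    {g : α → Fin l → ℝ} (hg : ∀ j, MemLp (fun s => g s j) 2 μ) (i : Fin k) :
    MemLp (fun s => (A (q s) *ᵥ g s) i) 2 μ := by
  simp only [mulVec, dotProduct]
  refine memLp_finsetSum _ fun j _ => ?_
  have hm : AEStronglyMeasurable (fun s => A (q s) i j) μ :=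
    ((Measurable.of_discrete (f := fun a : Fin M => A a i j)).comp_aemeasurable
      hq).aestronglyMeasurable
  refine (hg j).of_le_mul (c := ∑ a, |A a i j|) (hm.mul (hg j).1) (ae_of_all _ fun s => ?_)
  rw [norm_mul, Real.norm_eq_abs]
  gcongr
  exact Finset.single_le_sum (f := fun a => |A a i j|) (fun _ _ => abs_nonneg _)
    (Finset.mem_univ (q s))

theorem memLp_apply_of_continuousOn {n : ℕ} {T : ℝ} {x : ℝ → Fin n → ℝ}
    (hx : ContinuousOn x (Icc 0 T)) (i : Fin n) :
    MemLp (fun s => x s i) 2 (volume.restrict (Icc 0 T)) := by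
  have hi : ContinuousOn (fun s => x s i) (Icc 0 T) := (continuous_apply i).comp_continuousOn hx
  obtain ⟨b, hb⟩ := isCompact_Icc.exists_bound_of_continuousOn hi
  refine MemLp.of_bound (hi.aestronglyMeasurable measurableSet_Icc) b ?_
  filter_upwards [ae_restrict_mem measurableSet_Icc] with s hs using hb s hs

theorem norm_toLp_sq {k : ℕ} (v : Fin k → ℝ) : ‖WithLp.toLp 2 v‖ ^ 2 = v ⬝ᵥ v := by
  rw [EuclideanSpace.real_norm_sq_eq]
  simp [dotProduct, sq]

theorem eLpNorm_toLp_eq {α : Type*} [MeasurableSpace α] {μ : Measure α} {k : ℕ}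
    {f : α → Fin k → ℝ} (hf : MemLp (fun t => WithLp.toLp 2 (f t)) 2 μ) :
    eLpNorm (fun t => WithLp.toLp 2 (f t)) 2 μ =
      ENNReal.ofReal (Real.sqrt (∫ t, f t ⬝ᵥ f t ∂μ)) := by
  rw [hf.eLpNorm_eq_integral_rpow_norm two_ne_zero ENNReal.ofNat_ne_top, Real.sqrt_eq_rpow]
  simp [norm_toLp_sq]

theorem eLpNorm_toLp_le {α : Type*} [MeasurableSpace α] {μ : Measure α} {k l : ℕ}
    {f : α → Fin k → ℝ} {g : α → Fin l → ℝ} {c : ℝ} (hc : 0 ≤ c)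
    (hf : MemLp (fun t => WithLp.toLp 2 (f t)) 2 μ)
    (hg : MemLp (fun t => WithLp.toLp 2 (g t)) 2 μ)
    (h : ∫ t, f t ⬝ᵥ f t ∂μ ≤ c ^ 2 * ∫ t, g t ⬝ᵥ g t ∂μ) :
    eLpNorm (fun t => WithLp.toLp 2 (f t)) 2 μ ≤
      ENNReal.ofReal c * eLpNorm (fun t => WithLp.toLp 2 (g t)) 2 μ := by
  rw [eLpNorm_toLp_eq hf, eLpNorm_toLp_eq hg, ← ENNReal.ofReal_mul hc]
  refine ENNReal.ofReal_le_ofReal ?_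
  calc _ ≤ Real.sqrt (c ^ 2 * ∫ t, g t ⬝ᵥ g t ∂μ) := Real.sqrt_le_sqrt h
    _ = _ := by rw [Real.sqrt_mul (sq_nonneg c), Real.sqrt_sq hc]

/-! ### Trajectories on bounded intervals and dissipation. -/

namespace LSS

variable {M n m p : ℕ}

/-- The right-hand side of the state equation. -/
def rhs (sys : LSS M n m p) (q : ℝ → Fin M) (u : ℝ → Fin m → ℝ) (x : ℝ → Fin n → ℝ)
    (s : ℝ) : Fin n → ℝ :=
  sys.A (q s) *ᵥ x s + sys.B (q s) *ᵥ u s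

/-- `x` is a state trajectory on `[0, T]` from the zero initial state, stated componentwise. -/
structure IsTrajectoryOn (sys : LSS M n m p) (T : ℝ) (q : ℝ → Fin M) (u : ℝ → Fin m → ℝ)
    (x : ℝ → Fin n → ℝ) : Prop where
  continuousOn : ContinuousOn x (Icc 0 T)
  eq_integral : ∀ t ∈ Icc 0 T, ∀ i, x t i = ∫ s in (0 : ℝ)..t, sys.rhs q u x s i

variable {T : ℝ} {q : ℝ → Fin M} {u : ℝ → Fin m → ℝ} {x : ℝ → Fin n → ℝ}

theorem memLp_rhs (sys : LSS M n m p) (hq : AEMeasurable q (volume.restrict (Icc 0 T)))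
    (hu : ∀ j, MemLp (fun s => u s j) 2 (volume.restrict (Icc 0 T)))
    (hx : ContinuousOn x (Icc 0 T)) (i : Fin n) :
    MemLp (fun s => sys.rhs q u x s i) 2 (volume.restrict (Icc 0 T)) :=
  (memLp_mode_mulVec hq sys.A (memLp_apply_of_continuousOn hx) i).add
    (memLp_mode_mulVec hq sys.B hu i)

theorem integrableOn_rhs (sys : LSS M n m p) (hq : AEMeasurable q (volume.restrict (Icc 0 T)))
    (hu : ∀ j, MemLp (fun s => u s j) 2 (volume.restrict (Icc 0 T)))
    (hx : ContinuousOn x (Icc 0 T)) (i : Fin n) :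
    IntegrableOn (fun s => sys.rhs q u x s i) (Icc 0 T) :=
  (sys.memLp_rhs hq hu hx i).integrable one_le_two

theorem intervalIntegral_apply {n : ℕ} {T t : ℝ} {f : ℝ → Fin n → ℝ}
    (hf : ∀ i, IntegrableOn (fun s => f s i) (Icc 0 T)) (ht : t ∈ Icc 0 T) (i : Fin n) :
    (∫ s in (0 : ℝ)..t, f s) i = ∫ s in (0 : ℝ)..t, f s i := by
  rw [intervalIntegral.integral_of_le ht.1, intervalIntegral.integral_of_le ht.1]
  exact eval_integral (fun i => (hf i).mono_set
    (Ioc_subset_Icc_self.trans (Icc_subset_Icc_right ht.2))) i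

theorem IsTrajectory.isTrajectoryOn {sys : LSS M n m p} (h : sys.IsTrajectory 0 q u x)
    (hq : AEMeasurable q (volume.restrict (Icc 0 T)))
    (hu : ∀ j, MemLp (fun s => u s j) 2 (volume.restrict (Icc 0 T))) :
    sys.IsTrajectoryOn T q u x where
  continuousOn := h.continuousOn.mono fun _ ht => ht.1
  eq_integral t ht i := by
    rw [h.eq_integral t ht.1, zero_add]
    exact intervalIntegral_apply (fun i => sys.integrableOn_rhs hq hu
      (h.continuousOn.mono fun _ ht => ht.1) i) ht i

theorem exists_isTrajectoryOn (sys : LSS M n m p) (hT : 0 ≤ T)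
    (hq : AEMeasurable q (volume.restrict (Icc 0 T)))
    (hu : ∀ j, MemLp (fun s => u s j) 2 (volume.restrict (Icc 0 T))) :
    ∃ x, sys.IsTrajectoryOn T q u x := by
  let Ψ : Fin M → (Fin n → ℝ) →L[ℝ] (Fin n → ℝ) := fun k =>
    (mulVecLin (sys.A k)).toContinuousLinearMap
  obtain ⟨x, hx, h⟩ := exists_continuousOn_eq_integral (a := ∑ k, ‖Ψ k‖) hT
    (fun s => Ψ (q s)) (fun s => sys.B (q s) *ᵥ u s)
    (Integrable.of_eval fun i => (memLp_mode_mulVec hq sys.B hu i).integrable one_le_two)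
    (fun s => Finset.single_le_sum (f := fun a => ‖Ψ a‖) (fun _ _ => norm_nonneg _)
      (Finset.mem_univ (q s)))
    (fun x hx => (MemLp.of_eval (p := 2) fun i => memLp_mode_mulVec hq sys.A
      (memLp_apply_of_continuousOn hx.continuousOn) i).1)
  refine ⟨x, hx.continuousOn, fun t ht i => ?_⟩
  rw [h t ht]
  exact intervalIntegral_apply (fun i => sys.integrableOn_rhs hq hu hx.continuousOn i) ht i

/-- The system obtained by freezing all state coordinates outside `K`. -/
def mask (sys : LSS M n m p) (K : Finset (Fin n)) : LSS M n m p where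
  A j := of fun i l => if i ∈ K then sys.A j i l else 0
  B j := of fun i l => if i ∈ K then sys.B j i l else 0
  C := sys.C

theorem mask_rhs (sys : LSS M n m p) (K : Finset (Fin n)) (s : ℝ) (i : Fin n) :
    (sys.mask K).rhs q u x s i = if i ∈ K then sys.rhs q u x s i else 0 := by
  by_cases h : i ∈ K <;> simp [rhs, mask, mulVec, dotProduct, h]

theorem mask_univ (sys : LSS M n m p) : sys.mask Finset.univ = sys := by
  cases sys; simp [mask]; exact ⟨rfl, rfl⟩

theorem IsTrajectoryOn.apply_eq_zero {sys : LSS M n m p} {K : Finset (Fin n)}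
    (h : (sys.mask K).IsTrajectoryOn T q u x) {t : ℝ} (ht : t ∈ Icc 0 T) {i : Fin n}
    (hi : i ∉ K) : x t i = 0 := by
  rw [h.eq_integral t ht i]
  simp [mask_rhs, hi]

/-- The Lyapunov inequalities of all modes hold with both Gramians equal to `diag σ`. -/
structure IsBalanced (sys : LSS M n m p) (σ : Fin n → ℝ) : Prop where
  pos : ∀ i, 0 < σ i
  obs : ∀ k e, 2 * ((diagonal σ *ᵥ e) ⬝ᵥ (sys.A k *ᵥ e)) +
    (sys.C k *ᵥ e) ⬝ᵥ (sys.C k *ᵥ e) ≤ 0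
  reach : ∀ k v, 2 * (v ⬝ᵥ (sys.A k *ᵥ (diagonal σ *ᵥ v))) +
    ((sys.B k)ᵀ *ᵥ v) ⬝ᵥ ((sys.B k)ᵀ *ᵥ v) ≤ 0

/-- Expands |v - 2u|² ≥ 0. Multiplied by σ_k², the coefficient 4 becomes the squared gain (2σ_k)².
-/
theorem _root_.four_mul_dotProduct_le {m : ℕ} (v u : Fin m → ℝ) :
    4 * (v ⬝ᵥ u) ≤ v ⬝ᵥ v + 4 * (u ⬝ᵥ u) := by
  simp only [dotProduct, Finset.mul_sum, ← Finset.sum_add_distrib]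
  exact Finset.sum_le_sum fun i _ => by nlinarith [sq_nonneg (v i - 2 * u i)]

/-- Pointwise dissipation inequality for the error between the systems that retain the state
coordinates `insert k K` and `K`. -/
theorem IsBalanced.dissipation {sys : LSS M n m p} {σ : Fin n → ℝ} (h : sys.IsBalanced σ)
    (j : Fin M) {K : Finset (Fin n)} {k : Fin n} (hk : k ∉ K) {x z F G : Fin n → ℝ}
    (u : Fin m → ℝ) (hx : ∀ i ∉ insert k K, x i = 0) (hz : ∀ i ∉ K, z i = 0)
    (hF : F = sys.A j *ᵥ x + sys.B j *ᵥ u) (hG : G = sys.A j *ᵥ z + sys.B j *ᵥ u) :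
    (∑ i, σ i * (2 * ((x i - z i) * ((if i ∈ insert k K then F i else 0)
        - (if i ∈ K then G i else 0)))))
      + σ k ^ 2 * ∑ i, (σ i)⁻¹ * (2 * ((x i + z i) * ((if i ∈ insert k K then F i else 0)
        + (if i ∈ K then G i else 0))))
      ≤ (2 * σ k) ^ 2 * (u ⬝ᵥ u) -
        (sys.C j *ᵥ x - sys.C j *ᵥ z) ⬝ᵥ (sys.C j *ᵥ x - sys.C j *ᵥ z) := by
  have hσ := h.pos
  -- Coordinate `k` moves in the first system but is frozen in the second, so the sum differs from
  -- the unmasked form by a term containing `G k`.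
  have h1 : (∑ i, σ i * (2 * ((x i - z i) * ((if i ∈ insert k K then F i else 0)
        - (if i ∈ K then G i else 0))))) =
      2 * ((diagonal σ *ᵥ (x - z)) ⬝ᵥ (F - G)) + 2 * (σ k * x k * G k) := by
    have : 2 * (σ k * x k * G k) = ∑ i, if i = k then 2 * (σ i * x i * G i) else 0 := by simp
    rw [this]
    simp only [dotProduct, mulVec_diagonal, Finset.mul_sum, ← Finset.sum_add_distrib]
    refine Finset.sum_congr rfl fun i _ => ?_
    rcases eq_or_ne i k with rfl | hik
    · simp only [Pi.sub_apply, hz _ hk, Finset.mem_insert_self, if_true, hk, if_false]; ring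
    · by_cases hi : i ∈ K
      · simp only [Pi.sub_apply, Finset.mem_insert, hi, hik, or_true, if_true, if_false]; ring
      · have hi' : i ∉ insert k K := by simp [hi, hik]
        simp only [Pi.sub_apply, hi, hi', hik, hx i hi', hz i hi, if_false]; ring
  -- The vector Σ⁻¹(x+z) is the argument at which the reachability inequality bounds the second
  -- storage term.
  set v : Fin n → ℝ := fun i => (σ i)⁻¹ * (x i + z i) with hv
  have h2 : (∑ i, (σ i)⁻¹ * (2 * ((x i + z i) * ((if i ∈ insert k K then F i else 0)
        + (if i ∈ K then G i else 0))))) =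
      2 * (v ⬝ᵥ (F + G)) - 2 * ((σ k)⁻¹ * x k * G k) := by
    have : 2 * ((σ k)⁻¹ * x k * G k) = ∑ i, if i = k then 2 * ((σ i)⁻¹ * x i * G i) else 0 := by
      simp
    rw [this]
    simp only [dotProduct, Finset.mul_sum, ← Finset.sum_sub_distrib]
    refine Finset.sum_congr rfl fun i _ => ?_
    rcases eq_or_ne i k with rfl | hik
    · simp only [hv, Pi.add_apply, hz _ hk, Finset.mem_insert_self, if_true, hk, if_false]; ring
    · by_cases hi : i ∈ K
      · simp only [hv, Pi.add_apply, Finset.mem_insert, hi, hik, or_true, if_true, if_false]; ring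
      · have hi' : i ∉ insert k K := by simp [hi, hik]
        simp only [hv, Pi.add_apply, hi, hi', hik, hx i hi', hz i hi, if_false]; ring
  have hFG : F - G = sys.A j *ᵥ (x - z) := by rw [hF, hG, mulVec_sub]; abel
  have hsv : diagonal σ *ᵥ v = x + z := by
    ext i
    rw [mulVec_diagonal, hv, mul_inv_cancel_left₀ (hσ i).ne', Pi.add_apply]
  have hFG' : F + G = sys.A j *ᵥ (diagonal σ *ᵥ v) + (2 : ℝ) • (sys.B j *ᵥ u) := by
    rw [hsv, hF, hG, mulVec_add, two_smul]; abel
  have h3 := h.obs j (x - z)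
  have h4 := h.reach j v
  have h5 : v ⬝ᵥ (sys.B j *ᵥ u) = ((sys.B j)ᵀ *ᵥ v) ⬝ᵥ u := by
    rw [dotProduct_mulVec, mulVec_transpose]
  have h6 := four_mul_dotProduct_le ((sys.B j)ᵀ *ᵥ v) u
  rw [h1, h2, hFG, hFG', dotProduct_add, dotProduct_smul, h5, ← mulVec_sub, smul_eq_mul]
  have h7 : σ k ^ 2 * (2 * (v ⬝ᵥ (sys.A j *ᵥ (diagonal σ *ᵥ v)) +
      2 * (((sys.B j)ᵀ *ᵥ v) ⬝ᵥ u))) ≤ σ k ^ 2 * (4 * (u ⬝ᵥ u)) :=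
    mul_le_mul_of_nonneg_left (by linarith) (sq_nonneg _)
  -- The weight σ_k² in the storage function is what makes the two defects at coordinate `k` cancel.
  have h8 : σ k ^ 2 * (2 * ((σ k)⁻¹ * x k * G k)) = 2 * (σ k * x k * G k) := by
    have := (hσ k).ne'
    field_simp
  rw [mul_sub, h8]
  linarith

theorem memLp_output (sys : LSS M n m p) (hq : AEMeasurable q (volume.restrict (Icc 0 T)))
    (hx : ContinuousOn x (Icc 0 T)) :
    MemLp (fun t => WithLp.toLp 2 (sys.output q x t)) 2 (volume.restrict (Icc 0 T)) :=
  MemLp.of_eval_piLp fun i => memLp_mode_mulVec hq sys.C (memLp_apply_of_continuousOn hx) i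

/-- The integral equals `(e T i) ^ 2`, because `e` starts at zero. This is how the terminal storage
is discarded. -/
theorem _root_.integral_two_mul_mul_nonneg {n : ℕ} {T : ℝ} (hT : 0 ≤ T) {e f : ℝ → Fin n → ℝ}
    (hf : ∀ i, IntegrableOn (fun s => f s i) (Icc 0 T))
    (he : ∀ t ∈ Icc 0 T, ∀ i, e t i = ∫ s in (0 : ℝ)..t, f s i) (i : Fin n) :
    0 ≤ ∫ t in Icc 0 T, 2 * (e t i * f t i) := by
  rw [integral_Icc_eq_integral_Ioc, ← intervalIntegral.integral_of_le hT]
  have h1 := sq_intervalIntegral_eq (φ := fun s => f s i) (a := 0) (T := T)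
    (((hf i).mono_set (by rw [uIcc_of_le hT])).intervalIntegrable)
  have h2 : ∫ t in (0 : ℝ)..T, 2 * (e t i * f t i) =
      ∫ t in (0 : ℝ)..T, 2 * ((∫ s in (0 : ℝ)..t, f s i) * f t i) := by
    refine intervalIntegral.integral_congr fun t ht => ?_
    rw [uIcc_of_le hT] at ht
    simp only [he t ht i]
  rw [h2, ← h1]
  positivity

theorem integrableOn_dotProduct_self {l : ℕ} {f : ℝ → Fin l → ℝ}
    (hf : MemLp (fun t => WithLp.toLp 2 (f t)) 2 (volume.restrict (Icc 0 T))) :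
    IntegrableOn (fun t => f t ⬝ᵥ f t) (Icc 0 T) := by
  simpa only [norm_toLp_sq, IntegrableOn] using hf.integrable_norm_pow two_ne_zero

theorem intervalIntegrable_of_mem_Icc {t : ℝ} (ht : t ∈ Icc 0 T) {φ : ℝ → ℝ}
    (hφ : IntegrableOn φ (Icc 0 T)) : IntervalIntegrable φ volume 0 t :=
  (hφ.mono_set (by rw [uIcc_of_le ht.1]; exact Icc_subset_Icc_right ht.2)).intervalIntegrable

/-- Error bound for the removal of one state coordinate. -/
theorem IsBalanced.eLpNorm_output_sub_le {sys : LSS M n m p} {σ : Fin n → ℝ}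
    (h : sys.IsBalanced σ) (hT : 0 ≤ T) (hq : AEMeasurable q (volume.restrict (Icc 0 T)))
    (hu : MemLp (fun t => WithLp.toLp 2 (u t)) 2 (volume.restrict (Icc 0 T)))
    {K : Finset (Fin n)} {k : Fin n} (hk : k ∉ K) {x z : ℝ → Fin n → ℝ}
    (hx : (sys.mask (insert k K)).IsTrajectoryOn T q u x)
    (hz : (sys.mask K).IsTrajectoryOn T q u z) :
    eLpNorm (fun t => WithLp.toLp 2 (sys.output q x t - sys.output q z t)) 2
        (volume.restrict (Icc 0 T)) ≤
      ENNReal.ofReal (2 * σ k) *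
        eLpNorm (fun t => WithLp.toLp 2 (u t)) 2 (volume.restrict (Icc 0 T)) := by
  have hu' : ∀ j, MemLp (fun s => u s j) 2 (volume.restrict (Icc 0 T)) := hu.eval_piLp
  have hC : MemLp (fun t => WithLp.toLp 2 (sys.output q x t - sys.output q z t)) 2
      (volume.restrict (Icc 0 T)) :=
    (sys.memLp_output hq hx.continuousOn).sub (sys.memLp_output hq hz.continuousOn)
  refine eLpNorm_toLp_le (by linarith [h.pos k]) hC hu ?_
  set f := fun s => (sys.mask (insert k K)).rhs q u x s with hf
  set g := fun s => (sys.mask K).rhs q u z s with hg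
  have hf2 := (sys.mask (insert k K)).memLp_rhs hq hu' hx.continuousOn
  have hg2 := (sys.mask K).memLp_rhs hq hu' hz.continuousOn
  have hx2 := memLp_apply_of_continuousOn hx.continuousOn
  have hz2 := memLp_apply_of_continuousOn hz.continuousOn
  have hfi : ∀ i, IntegrableOn (fun s => f s i) (Icc 0 T) := fun i =>
    (hf2 i).integrable one_le_two
  have hgi : ∀ i, IntegrableOn (fun s => g s i) (Icc 0 T) := fun i =>
    (hg2 i).integrable one_le_two
  have he : ∀ i, 0 ≤ ∫ t in Icc 0 T, 2 * ((x t i - z t i) * (f t i - g t i)) := fun i =>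
    integral_two_mul_mul_nonneg hT (e := fun t => x t - z t) (f := fun t => f t - g t)
      (fun i => (hfi i).sub (hgi i)) (fun t ht i => by
        simp only [Pi.sub_apply]
        rw [intervalIntegral.integral_sub (intervalIntegrable_of_mem_Icc ht (hfi i)) (intervalIntegrable_of_mem_Icc ht (hgi i)),
          hx.eq_integral t ht, hz.eq_integral t ht]) i
  have hs : ∀ i, 0 ≤ ∫ t in Icc 0 T, 2 * ((x t i + z t i) * (f t i + g t i)) := fun i =>
    integral_two_mul_mul_nonneg hT (e := fun t => x t + z t) (f := fun t => f t + g t)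
      (fun i => (hfi i).add (hgi i)) (fun t ht i => by
        simp only [Pi.add_apply]
        rw [intervalIntegral.integral_add (intervalIntegrable_of_mem_Icc ht (hfi i)) (intervalIntegrable_of_mem_Icc ht (hgi i)),
          hx.eq_integral t ht, hz.eq_integral t ht]) i
  have hei : ∀ i, IntegrableOn (fun t => σ i * (2 * ((x t i - z t i) * (f t i - g t i))))
      (Icc 0 T) := fun i =>
    ((((hx2 i).sub (hz2 i)).integrable_mul ((hf2 i).sub (hg2 i))).const_mul 2).const_mul _
  have hsi : ∀ i, IntegrableOn (fun t => (σ i)⁻¹ * (2 * ((x t i + z t i) * (f t i + g t i))))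
      (Icc 0 T) := fun i =>
    ((((hx2 i).add (hz2 i)).integrable_mul ((hf2 i).add (hg2 i))).const_mul 2).const_mul _
  have hle : ∀ t ∈ Icc 0 T,
      (∑ i, σ i * (2 * ((x t i - z t i) * (f t i - g t i))))
        + σ k ^ 2 * ∑ i, (σ i)⁻¹ * (2 * ((x t i + z t i) * (f t i + g t i))) ≤
      (2 * σ k) ^ 2 * (u t ⬝ᵥ u t) -
        (sys.output q x t - sys.output q z t) ⬝ᵥ (sys.output q x t - sys.output q z t) := by
    intro t ht
    have := h.dissipation (q t) hk (x := x t) (z := z t) (u t)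
      (fun i hi => hx.apply_eq_zero ht hi) (fun i hi => hz.apply_eq_zero ht hi) rfl rfl
    simp only [hf, hg, mask_rhs]
    exact this
  have hsum1 := integrable_finsetSum Finset.univ fun i _ => hei i
  have hsum2 := (integrable_finsetSum Finset.univ fun i _ => hsi i).const_mul (σ k ^ 2)
  have hint := setIntegral_mono_on (hsum1.add hsum2) (((integrableOn_dotProduct_self hu).const_mul _).sub (integrableOn_dotProduct_self hC))
    measurableSet_Icc hle
  rw [integral_sub' ((integrableOn_dotProduct_self hu).const_mul _) (integrableOn_dotProduct_self hC), integral_const_mul] at hint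
  have hnn : 0 ≤ ∫ t in Icc 0 T, ((∑ i, σ i * (2 * ((x t i - z t i) * (f t i - g t i))))
        + σ k ^ 2 * ∑ i, (σ i)⁻¹ * (2 * ((x t i + z t i) * (f t i + g t i)))) := by
    rw [integral_add hsum1 hsum2, integral_const_mul, integral_finsetSum _ fun i _ => hei i,
      integral_finsetSum _ fun i _ => hsi i]
    refine add_nonneg (Finset.sum_nonneg fun i _ => ?_)
      (mul_nonneg (sq_nonneg _) (Finset.sum_nonneg fun i _ => ?_))
    · rw [integral_const_mul]; exact mul_nonneg (h.pos i).le (he i)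
    · rw [integral_const_mul]; exact mul_nonneg (inv_nonneg.2 (h.pos i).le) (hs i)
  exact sub_nonneg.1 (hnn.trans hint)

/-- Two trajectories for the same input and switching signal have the same output. -/
theorem IsBalanced.eLpNorm_output_sub_eq_zero {sys : LSS M n m p} {σ : Fin n → ℝ}
    (h : sys.IsBalanced σ) (hT : 0 ≤ T) (hq : AEMeasurable q (volume.restrict (Icc 0 T)))
    (hu : MemLp (fun t => WithLp.toLp 2 (u t)) 2 (volume.restrict (Icc 0 T)))
    {x z : ℝ → Fin n → ℝ} (hx : sys.IsTrajectoryOn T q u x) (hz : sys.IsTrajectoryOn T q u z) :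
    eLpNorm (fun t => WithLp.toLp 2 (sys.output q x t - sys.output q z t)) 2
        (volume.restrict (Icc 0 T)) = 0 := by
  have hu' : ∀ j, MemLp (fun s => u s j) 2 (volume.restrict (Icc 0 T)) := hu.eval_piLp
  have hC : MemLp (fun t => WithLp.toLp 2 (sys.output q x t - sys.output q z t)) 2
      (volume.restrict (Icc 0 T)) :=
    (sys.memLp_output hq hx.continuousOn).sub (sys.memLp_output hq hz.continuousOn)
  suffices H : ∫ t in Icc 0 T, (sys.output q x t - sys.output q z t) ⬝ᵥ
      (sys.output q x t - sys.output q z t) ≤ 0 by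
    rw [eLpNorm_toLp_eq hC, Real.sqrt_eq_zero_of_nonpos H, ENNReal.ofReal_zero]
  set f := fun s => sys.rhs q u x s with hf
  set g := fun s => sys.rhs q u z s with hg
  have hf2 := sys.memLp_rhs hq hu' hx.continuousOn
  have hg2 := sys.memLp_rhs hq hu' hz.continuousOn
  have hx2 := memLp_apply_of_continuousOn hx.continuousOn
  have hz2 := memLp_apply_of_continuousOn hz.continuousOn
  have hfi : ∀ i, IntegrableOn (fun s => f s i) (Icc 0 T) := fun i =>
    (hf2 i).integrable one_le_two
  have hgi : ∀ i, IntegrableOn (fun s => g s i) (Icc 0 T) := fun i =>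
    (hg2 i).integrable one_le_two
  have he : ∀ i, 0 ≤ ∫ t in Icc 0 T, 2 * ((x t i - z t i) * (f t i - g t i)) := fun i =>
    integral_two_mul_mul_nonneg hT (e := fun t => x t - z t) (f := fun t => f t - g t)
      (fun i => (hfi i).sub (hgi i)) (fun t ht i => by
        simp only [Pi.sub_apply]
        rw [intervalIntegral.integral_sub (intervalIntegrable_of_mem_Icc ht (hfi i))
          (intervalIntegrable_of_mem_Icc ht (hgi i)), hx.eq_integral t ht, hz.eq_integral t ht]) i
  have hei : ∀ i, IntegrableOn (fun t => σ i * (2 * ((x t i - z t i) * (f t i - g t i))))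
      (Icc 0 T) := fun i =>
    ((((hx2 i).sub (hz2 i)).integrable_mul ((hf2 i).sub (hg2 i))).const_mul 2).const_mul _
  -- The difference x-z solves the homogeneous equation from zero, so the observability inequality
  -- alone bounds its output energy by minus the terminal storage. Uniqueness of trajectories is not
  -- needed.
  have hle : ∀ t ∈ Icc 0 T, (sys.output q x t - sys.output q z t) ⬝ᵥ
      (sys.output q x t - sys.output q z t) ≤
      -∑ i, σ i * (2 * ((x t i - z t i) * (f t i - g t i))) := by
    intro t _
    have h1 := h.obs (q t) (x t - z t)
    have h2 : f t - g t = sys.A (q t) *ᵥ (x t - z t) := by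
      simp only [hf, hg, rhs, mulVec_sub]; abel
    have h3 : ∑ i, σ i * (2 * ((x t i - z t i) * (f t i - g t i))) =
        2 * ((diagonal σ *ᵥ (x t - z t)) ⬝ᵥ (f t - g t)) := by
      simp only [dotProduct, mulVec_diagonal, Finset.mul_sum, Pi.sub_apply]
      exact Finset.sum_congr rfl fun i _ => by ring
    rw [h3, h2, output, output, ← mulVec_sub]
    linarith
  have hsum := integrable_finsetSum Finset.univ fun i _ => hei i
  have hint := setIntegral_mono_on (integrableOn_dotProduct_self hC) hsum.neg
    measurableSet_Icc hle
  refine hint.trans ?_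
  rw [integral_neg', integral_finsetSum _ fun i _ => hei i, neg_nonpos]
  refine Finset.sum_nonneg fun i _ => ?_
  rw [integral_const_mul]
  exact mul_nonneg (h.pos i).le (he i)

end LSS

/-! ### Removal of several coordinates. -/

namespace LSS

variable {M n m p : ℕ} {T : ℝ} {q : ℝ → Fin M} {u : ℝ → Fin m → ℝ}

/-- Error bound for the removal of a set of state coordinates. -/
theorem IsBalanced.eLpNorm_output_sub_mask_le {sys : LSS M n m p} {σ : Fin n → ℝ}
    (h : sys.IsBalanced σ) (hT : 0 ≤ T) (hq : AEMeasurable q (volume.restrict (Icc 0 T)))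
    (hu : MemLp (fun t => WithLp.toLp 2 (u t)) 2 (volume.restrict (Icc 0 T)))
    {x : ℝ → Fin n → ℝ} (hx : sys.IsTrajectoryOn T q u x) (s : Finset (Fin n)) :
    ∀ z, (sys.mask sᶜ).IsTrajectoryOn T q u z →
    eLpNorm (fun t => WithLp.toLp 2 (sys.output q x t - sys.output q z t)) 2
        (volume.restrict (Icc 0 T)) ≤
      ENNReal.ofReal (2 * ∑ k ∈ s, σ k) *
        eLpNorm (fun t => WithLp.toLp 2 (u t)) 2 (volume.restrict (Icc 0 T)) := by
  induction s using Finset.induction_on with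
  | empty =>
    intro z hz
    rw [Finset.compl_empty, mask_univ] at hz
    rw [h.eLpNorm_output_sub_eq_zero hT hq hu hx hz]
    exact zero_le
  | insert k s hk ih =>
    intro z hz
    have hins : insert k (insert k s)ᶜ = sᶜ := by
      ext i
      by_cases hi : i = k
      · simp [hi, hk]
      · simp [hi]
    -- The intermediate system is not part of the data, so its trajectory has to be constructed
    -- before the triangle inequality can be applied.
    obtain ⟨w, hw⟩ := (sys.mask sᶜ).exists_isTrajectoryOn hT hq hu.eval_piLp
    have h1 := ih w hw
    have h2 := h.eLpNorm_output_sub_le hT hq hu (K := (insert k s)ᶜ) (k := k) (by simp)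
      (by rwa [hins]) hz
    have hxm := sys.memLp_output hq hx.continuousOn
    have hwm := sys.memLp_output hq hw.continuousOn
    have hzm := sys.memLp_output hq hz.continuousOn
    have hadd := eLpNorm_add_le (hxm.sub hwm).1 (hwm.sub hzm).1 one_le_two
    have hsum : 0 ≤ ∑ k ∈ s, σ k := Finset.sum_nonneg fun i _ => (h.pos i).le
    calc _ ≤ _ := by
          refine le_trans (le_of_eq ?_) hadd
          congr 1
          ext1 t
          simp only [Pi.add_apply, Pi.sub_apply, WithLp.toLp_sub]
          abel
      _ ≤ _ := add_le_add h1 h2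
      _ = _ := by
          rw [← add_mul, ← ENNReal.ofReal_add (by positivity) (by linarith [h.pos k]),
            Finset.sum_insert hk]
          ring_nf

end LSS

/-! ### Identification of the reduced model with a masked balanced system. -/

/-- The first r columns of the identity extend a vector of ℝʳ by zeros to ℝⁿ. -/
theorem Matrix.submatrix_one_mulVec_castLE {n r : ℕ} (hr : r ≤ n) (v : Fin r → ℝ) (a : Fin r) :
    ((1 : Matrix (Fin n) (Fin n) ℝ).submatrix id (Fin.castLE hr) *ᵥ v) (Fin.castLE hr a) = v a := by
  simp [mulVec, dotProduct, one_apply]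

theorem Matrix.submatrix_one_mulVec_of_le {n r : ℕ} (hr : r ≤ n) (v : Fin r → ℝ) {i : Fin n}
    (hi : r ≤ i) :
    ((1 : Matrix (Fin n) (Fin n) ℝ).submatrix id (Fin.castLE hr) *ᵥ v) i = 0 := by
  simp only [mulVec, dotProduct, submatrix_apply]
  refine Finset.sum_eq_zero fun a _ => ?_
  rw [one_apply_ne, zero_mul]
  rintro rfl
  exact absurd a.2 (not_lt.2 hi)

theorem Matrix.mulVec_submatrix_one_mulVec {n r l : ℕ} (hr : r ≤ n)
    (A : Matrix (Fin l) (Fin n) ℝ) (v : Fin r → ℝ) :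
    A *ᵥ ((1 : Matrix (Fin n) (Fin n) ℝ).submatrix id (Fin.castLE hr) *ᵥ v) =
      A.submatrix id (Fin.castLE hr) *ᵥ v := by
  rw [mulVec_mulVec]
  congr 1
  ext i j
  simp [mul_apply, one_apply]

namespace BalancingFactors

variable {M n m p : ℕ} {P Q : Matrix (Fin n) (Fin n) ℝ} (F : BalancingFactors P Q)
  {T : ℝ} {q : ℝ → Fin M} {u : ℝ → Fin m → ℝ}

theorem isBalanced_reduced [NeZero M] {sys : LSS M n m p} (h : sys.GramianAssumption P Q) :
    (F.reduced sys le_rfl).IsBalanced F.σ where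
  pos := F.sigma_pos h.posDef_P h.posDef_Q
  obs k := F.reduced_obs sys (by simpa using h.posDef_Q.isHermitian.eq) k (h.obs_lyapunov k)
  reach k := F.reduced_reach sys (by simpa using h.posDef_P.isHermitian.eq) k
    (h.reach_lyapunov k)

theorem reduced_A_eq (sys : LSS M n m p) {r : ℕ} (hr : r ≤ n) (k : Fin M) :
    (F.reduced sys hr).A k =
      ((F.reduced sys le_rfl).A k).submatrix (Fin.castLE hr) (Fin.castLE hr) := by
  simp only [reduced, LSS.project]
  rw [F.projV_eq_submatrix hr, F.projW_eq_submatrix hr]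
  rfl

theorem reduced_B_eq (sys : LSS M n m p) {r : ℕ} (hr : r ≤ n) (k : Fin M) :
    (F.reduced sys hr).B k = ((F.reduced sys le_rfl).B k).submatrix (Fin.castLE hr) id := by
  simp only [reduced, LSS.project]
  rw [F.projW_eq_submatrix hr]
  rfl

theorem reduced_C_eq (sys : LSS M n m p) {r : ℕ} (hr : r ≤ n) (k : Fin M) :
    (F.reduced sys hr).C k = ((F.reduced sys le_rfl).C k).submatrix id (Fin.castLE hr) := by
  simp only [reduced, LSS.project]
  rw [F.projV_eq_submatrix hr]
  rfl

/-- The square matrices satisfy WᵀV = 1, hence also VWᵀ = 1, and x ↦ Wᵀx is an invertible change of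
state coordinates. -/
theorem isTrajectoryOn_fullW {sys : LSS M n m p} (hσ : ∀ i, 0 < F.σ i) {x : ℝ → Fin n → ℝ}
    (hq : AEMeasurable q (volume.restrict (Icc 0 T)))
    (hu : ∀ j, MemLp (fun s => u s j) 2 (volume.restrict (Icc 0 T)))
    (hx : sys.IsTrajectoryOn T q u x) :
    (F.reduced sys le_rfl).IsTrajectoryOn T q u (fun t => F.fullWᵀ *ᵥ x t) where
  continuousOn := (by fun_prop : Continuous fun v : Fin n → ℝ => F.fullWᵀ *ᵥ v).comp_continuousOn
    hx.continuousOn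
  eq_integral t ht i := by
    have hVW := mul_eq_one_comm.1 (F.fullW_transpose_mul_fullV hσ)
    have h1 : ∀ s, (F.reduced sys le_rfl).rhs q u (fun t => F.fullWᵀ *ᵥ x t) s =
        F.fullWᵀ *ᵥ sys.rhs q u x s := by
      intro s
      simp only [LSS.rhs, reduced, LSS.project, mulVec_add, mulVec_mulVec, Matrix.mul_assoc, hVW,
        Matrix.mul_one]
    simp only [h1]
    simp only [mulVec, dotProduct]
    rw [intervalIntegral.integral_finsetSum fun j _ =>
      (LSS.intervalIntegrable_of_mem_Icc ht
        (sys.integrableOn_rhs hq hu hx.continuousOn j)).const_mul _]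
    refine Finset.sum_congr rfl fun j _ => ?_
    rw [intervalIntegral.integral_const_mul, hx.eq_integral t ht]

theorem output_fullW (sys : LSS M n m p) (hσ : ∀ i, 0 < F.σ i) (x : ℝ → Fin n → ℝ) :
    (F.reduced sys le_rfl).output q (fun t => F.fullWᵀ *ᵥ x t) = sys.output q x := by
  have hVW := mul_eq_one_comm.1 (F.fullW_transpose_mul_fullV hσ)
  ext1 t
  simp only [LSS.output, reduced, LSS.project, mulVec_mulVec, Matrix.mul_assoc, hVW,
    Matrix.mul_one]

/-- On zero-extended states the retained rows of the balanced system act as the reduced model, and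
the remaining rows are zero on both sides. -/
theorem isTrajectoryOn_mask {sys : LSS M n m p} {r : ℕ} (hr : r ≤ n) {z : ℝ → Fin r → ℝ}
    (hz : (F.reduced sys hr).IsTrajectoryOn T q u z) :
    ((F.reduced sys le_rfl).mask ({k : Fin n | r ≤ k.val} : Finset (Fin n))ᶜ).IsTrajectoryOn T q u
      (fun t => (1 : Matrix (Fin n) (Fin n) ℝ).submatrix id (Fin.castLE hr) *ᵥ z t) where
  continuousOn := (by fun_prop : Continuous fun v : Fin r → ℝ =>
    (1 : Matrix (Fin n) (Fin n) ℝ).submatrix id (Fin.castLE hr) *ᵥ v).comp_continuousOn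
      hz.continuousOn
  eq_integral t ht i := by
    simp only [LSS.mask_rhs]
    rcases lt_or_ge i.val r with hi | hi
    · obtain ⟨a, rfl⟩ : ∃ a : Fin r, i = Fin.castLE hr a := ⟨⟨i, hi⟩, rfl⟩
      rw [submatrix_one_mulVec_castLE, hz.eq_integral t ht]
      refine intervalIntegral.integral_congr fun s _ => ?_
      simp only [Finset.compl_filter, Finset.mem_filter, Finset.mem_univ, true_and, Fin.val_castLE,
        not_le, a.2, if_true]
      simp only [LSS.rhs, mulVec_submatrix_one_mulVec]
      rw [F.reduced_A_eq, F.reduced_B_eq]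
      rfl
    · rw [submatrix_one_mulVec_of_le hr _ hi]
      simp [hi.not_gt]

theorem output_mask (sys : LSS M n m p) {r : ℕ} (hr : r ≤ n) (z : ℝ → Fin r → ℝ) :
    (F.reduced sys le_rfl).output q
      (fun t => (1 : Matrix (Fin n) (Fin n) ℝ).submatrix id (Fin.castLE hr) *ᵥ z t) =
      (F.reduced sys hr).output q z := by
  ext1 t
  simp only [LSS.output, mulVec_submatrix_one_mulVec]
  rw [F.reduced_C_eq sys hr]

end BalancingFactors

/-! ### Passage to the half-line and conclusion. -/

/-- The integral over an increasing union of intervals is the supremum of the integrals, so a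
uniform finite bound yields both square integrability and the same bound. -/
theorem memLp_Ici_of_forall_Icc {E : Type*} [NormedAddCommGroup E] {f : ℝ → E} {c : ℝ≥0∞}
    (hc : c < ∞) (hf : ∀ T : ℝ, 0 ≤ T → AEStronglyMeasurable f (volume.restrict (Icc 0 T)))
    (h : ∀ T : ℝ, 0 ≤ T → eLpNorm f 2 (volume.restrict (Icc 0 T)) ≤ c) :
    MemLp f 2 (volume.restrict (Ici (0 : ℝ))) ∧
      eLpNorm f 2 (volume.restrict (Ici (0 : ℝ))) ≤ c := by
  have hU : Ici (0 : ℝ) = ⋃ N : ℕ, Icc (0 : ℝ) N := by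
    ext t
    simp only [mem_Ici, mem_iUnion, mem_Icc]
    exact ⟨fun ht => (exists_nat_ge t).imp fun N hN => ⟨ht, hN⟩, fun ⟨N, hN⟩ => hN.1⟩
  have hdir : Directed (· ⊆ ·) fun N : ℕ => Icc (0 : ℝ) N :=
    Monotone.directed_le fun a b hab => Icc_subset_Icc_right (by exact_mod_cast hab)
  have hle : eLpNorm f 2 (volume.restrict (Ici (0 : ℝ))) ≤ c := by
    rw [eLpNorm_eq_lintegral_rpow_enorm_toReal two_ne_zero ENNReal.ofNat_ne_top, one_div,
      ENNReal.rpow_inv_le_iff (by norm_num), hU, setLIntegral_iUnion_of_directed _ hdir]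
    refine iSup_le fun N => ?_
    have := h N N.cast_nonneg
    rwa [eLpNorm_eq_lintegral_rpow_enorm_toReal two_ne_zero ENNReal.ofNat_ne_top, one_div,
      ENNReal.rpow_inv_le_iff (by norm_num)] at this
  refine ⟨⟨?_, hle.trans_lt hc⟩, hle⟩
  rw [hU, aestronglyMeasurable_iUnion_iff]
  exact fun N => hf N N.cast_nonneg

theorem theorem4 {M n m p : ℕ} [NeZero M] (sys : LSS M n m p)
    (P Q : Matrix (Fin n) (Fin n) ℝ) (hPQ : sys.GramianAssumption P Q) :
    (∀ k : Fin M,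
      (-(sys.A k * P + P * (sys.A k)ᵀ + sys.B k * (sys.B k)ᵀ)).PosSemidef ∧
      (-((sys.A k)ᵀ * Q + Q * sys.A k + (sys.C k)ᵀ * sys.C k)).PosSemidef) ∧
    ∀ (F : BalancingFactors P Q) (r : ℕ) (hr : r ≤ n)
      (q : ℝ → Fin M) (_hq : IsSwitchingSignal q)
      (u : ℝ → Fin m → ℝ) (_hu : IsL2 u)
      (x : ℝ → Fin n → ℝ) (_hx : sys.IsTrajectory 0 q u x)
      (xr : ℝ → Fin r → ℝ) (_hxr : (F.reduced sys hr).IsTrajectory 0 q u xr),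
      IsL2 (fun t => sys.output q x t - (F.reduced sys hr).output q xr t) ∧
      normL2 (fun t => sys.output q x t - (F.reduced sys hr).output q xr t) ≤
        ENNReal.ofReal (2 * ∑ k : Fin n with r ≤ k.val, F.σ k) * normL2 u := by
  refine ⟨fun k => ⟨hPQ.reach_lyapunov k, hPQ.obs_lyapunov k⟩, ?_⟩
  intro F r hr q hq u hu x hx xr hxr
  have hσ := F.sigma_pos hPQ.posDef_P hPQ.posDef_Q
  have hmono : ∀ T : ℝ, volume.restrict (Icc 0 T) ≤ volume.restrict (Ici (0 : ℝ)) := fun T =>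
    Measure.restrict_mono Icc_subset_Ici_self le_rfl
  have hqT : ∀ T : ℝ, AEMeasurable q (volume.restrict (Icc 0 T)) := fun T =>
    hq.aemeasurable.mono_measure (hmono T)
  have huT : ∀ T : ℝ, MemLp (fun t => WithLp.toLp 2 (u t)) 2 (volume.restrict (Icc 0 T)) :=
    fun T => hu.mono_measure (hmono T)
  refine memLp_Ici_of_forall_Icc (ENNReal.mul_lt_top ENNReal.ofReal_lt_top hu.2) ?_ ?_
  · intro T _
    exact ((sys.memLp_output (hqT T) (hx.continuousOn.mono Icc_subset_Ici_self)).sub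
      ((F.reduced sys hr).memLp_output (hqT T) (hxr.continuousOn.mono Icc_subset_Ici_self))).1
  · intro T hT
    -- The removed set, fixed by unification with `isTrajectoryOn_mask`, consists of the indices
    -- with `r ≤ k`.
    have h1 := (F.isBalanced_reduced hPQ).eLpNorm_output_sub_mask_le hT (hqT T) (huT T)
      (F.isTrajectoryOn_fullW hσ (hqT T) (huT T).eval_piLp
        (hx.isTrajectoryOn (hqT T) (huT T).eval_piLp)) _ _
      (F.isTrajectoryOn_mask hr (hxr.isTrajectoryOn (hqT T) (huT T).eval_piLp))
    rw [F.output_fullW sys hσ, F.output_mask sys hr] at h1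
    exact h1.trans (mul_le_mul_right (eLpNorm_mono_measure _ (hmono T)) _)
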